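/- Let $\mathbb D$ be the open unit disk, $\mathbb T$ the unit circle, $\mathbb H=\{z\in\mathbb C:\operatorname{Re}z>0\}$ the open right half-plane, and write $\|\lambda\|=\max\{|\lambda^1|,|\lambda^2|\}$ for $\lambda=(\lambda^1,\lambda^2)\in\mathbb C^2$. Let $\varphi$ be a function in the Schur class of the bidisk, that is, a holomorphic function $\varphi:\mathbb D^2\to\mathbb C$ with $|\varphi|\le 1$, and let $\tau=(\tau^1,\tau^2)\in\mathbb T\times\mathbb D$ be a $B$-point of $\varphi$, that is, $$\alpha:=\liminf_{\lambda\to\tau,\ \lambda\in\mathbb D^2}\frac{1-|\varphi(\lambda)|}{1-\|\lambda\|}<\infty .$$ Then $\varphi$ has a nontangential limit at $\tau$, denoted $\varphi(\tau)$ (that is, $\varphi(\lambda)\to\varphi(\tau)$ as $\lambda\to\tau$ in $S$, for every set $S\subset\mathbb D^2$ having $\tau$ in its closure on which $\|\tau-\lambda\|/(1-\|\lambda\|)$ is bounded), and for every $\delta=(\delta^1,\delta^2)\in\tau^1\mathbb H\times\mathbb C$ the directional derivative $$D_{-\delta}\varphi(\tau)=\lim_{t\to0+}\frac{\varphi(\tau-t\delta)-\varphi(\tau)}{t}$$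 exists and $$D_{-\delta}\varphi(\tau)=-\varphi(\tau)\,\overline{\tau^1}\,\delta^1\,\liminf_{\lambda\to\tau,\ \lambda\in\mathbb D^2}\frac{1-|\varphi(\lambda)|}{1-\|\lambda\|}$$ (so the directional derivative is linear in $\delta$ and depends only on $\delta^1$). -/

import Mathlib

open Filter Topology

/-- The open unit bidisk `𝔻²` in `ℂ × ℂ`. -/
def bidisk : Set (ℂ × ℂ) := {p | ‖p.1‖ < 1 ∧ ‖p.2‖ < 1}

/-- The Schur class of the bidisk: holomorphic functions on `𝔻²` bounded by `1` in modulus.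
Values outside the bidisk are irrelevant. -/
def IsSchur (φ : ℂ × ℂ → ℂ) : Prop :=
  DifferentiableOn ℂ φ bidisk ∧ ∀ p ∈ bidisk, ‖φ p‖ ≤ 1

/-- The lower limit of `(1 - |φ(p)|) / (1 - ‖p‖)` as `p → τ` in `𝔻²`, as an extended real number;
`‖p‖ = max |p.1| |p.2|` is the norm of `ℂ × ℂ`. -/
noncomputable def caratheodoryLiminf (φ : ℂ × ℂ → ℂ) (τ : ℂ × ℂ) : EReal :=
  liminf (fun p : ℂ × ℂ => (((1 - ‖φ p‖) / (1 - ‖p‖) : ℝ) : EReal)) (𝓝[bidisk] τ)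

/-- A boundary point `τ` of the bidisk is a `B`-point of `φ` if the lower limit above is finite. -/
def IsBPoint (φ : ℂ × ℂ → ℂ) (τ : ℂ × ℂ) : Prop :=
  τ ∈ frontier bidisk ∧ caratheodoryLiminf φ τ < ⊤

/-- The set `S ⊆ 𝔻²` approaches `τ` nontangentially. -/
def ApproachesNontangentially (S : Set (ℂ × ℂ)) (τ : ℂ × ℂ) : Prop :=
  S ⊆ bidisk ∧ τ ∈ closure S ∧ ∃ c : ℝ, ∀ p ∈ S, ‖τ - p‖ ≤ c * (1 - ‖p‖)

/-- `ω` is the nontangential limit of `φ` at `τ`, that is, the boundary value `φ(τ)`. -/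
def HasNontangentialLimit (φ : ℂ × ℂ → ℂ) (τ : ℂ × ℂ) (ω : ℂ) : Prop :=
  ∀ S : Set (ℂ × ℂ), ApproachesNontangentially S τ → Tendsto φ (𝓝[S] τ) (𝓝 ω)

/-- `d` is the directional derivative at `τ` in the direction `η` of the function `φ` whose value
at the boundary point `τ` is `ω`: the limit of `(φ(τ + tη) - ω) / t` as `t → 0+`. -/
def HasDirectionalDeriv (φ : ℂ × ℂ → ℂ) (τ : ℂ × ℂ) (ω : ℂ) (η : ℂ × ℂ) (d : ℂ) : Prop :=
  Tendsto (fun t : ℝ => (φ (τ + t • η) - ω) / (t : ℂ)) (𝓝[>] 0) (𝓝 d)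

/-- The open right half-plane. -/
def rightHalfPlane : Set ℂ := {z | 0 < z.re}

open Metric ComplexConjugate

/-! Because `‖τ.2‖ < 1`, only the first coordinate approaches the boundary. Along an ultrafilter
realising the lower limit `a`, invariant Schwarz–Pick passes to the limit: the second coordinate's
contribution carries a factor `1 - ‖φ q‖ → 0` and disappears. This gives a Julia inequality in `p.1`
alone (`IsSchur.exists_julia`), with a unimodular `ω`; nontangential convergence to `ω` follows at
once.

For the derivative, freeze the second variable at `τ.2`. The slice is a function on the disc
satisfying Julia's inequality with constant `a`, and `a` bounds its radial quotients from below in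
the limit, so one-variable Julia–Carathéodory applies (`tendsto_of_julia`). Moving the second
variable by `O(t)` changes `φ` by at most `O(t) * ‖1 - conj (φ q) * φ p‖`. Both values tend to `ω`,
so this is `o(t)`, and `δ.2` has no influence. -/

/-! ### Schwarz–Pick on the disc and the bidisk -/

lemma norm_one_sub_conj_mul_sq (a b : ℂ) :
    ‖1 - conj a * b‖ ^ 2 = ‖b - a‖ ^ 2 + (1 - ‖a‖ ^ 2) * (1 - ‖b‖ ^ 2) := by
  simp only [Complex.sq_norm, Complex.normSq_apply, Complex.sub_re, Complex.sub_im, Complex.mul_re,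
    Complex.mul_im, Complex.conj_re, Complex.conj_im, Complex.one_re, Complex.one_im]
  ring

lemma one_sub_conj_mul_ne_zero {a b : ℂ} (ha : ‖a‖ < 1) (hb : ‖b‖ ≤ 1) : 1 - conj a * b ≠ 0 := by
  intro h
  have h1 : ‖conj a * b‖ = 1 := by rw [← sub_eq_zero.mp h, norm_one]
  rw [norm_mul, RCLike.norm_conj] at h1
  nlinarith [norm_nonneg a, norm_nonneg b]

lemma norm_sub_le_norm_one_sub_conj_mul {a b : ℂ} (ha : ‖a‖ ≤ 1) (hb : ‖b‖ ≤ 1) :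
    ‖b - a‖ ≤ ‖1 - conj a * b‖ := by
  refine le_of_sq_le_sq ?_ (norm_nonneg _)
  rw [norm_one_sub_conj_mul_sq]
  have := mul_nonneg (sub_nonneg.2 (pow_le_one₀ (n := 2) (norm_nonneg a) ha))
    (sub_nonneg.2 (pow_le_one₀ (n := 2) (norm_nonneg b) hb))
  linarith

/-- The **Schwarz–Pick lemma** at the centre of the unit ball of a normed space. -/
lemma schwarzPick_zero {E : Type*} [NormedAddCommGroup E] [NormedSpace ℂ E] {g : E → ℂ}
    (hg : DifferentiableOn ℂ g (ball 0 1)) (hb : ∀ v ∈ ball (0 : E) 1, ‖g v‖ ≤ 1)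
    {v : E} (hv : v ∈ ball (0 : E) 1) :
    ‖g v - g 0‖ ≤ ‖v‖ * ‖1 - conj (g 0) * g v‖ := by
  have h0 : (0 : E) ∈ ball (0 : E) 1 := mem_ball_self one_pos
  rcases (hb 0 h0).eq_or_lt with h1 | h1
  · have := Complex.eqOn_of_isPreconnected_of_isMaxOn_norm (convex_ball (0 : E) 1).isPreconnected
      isOpen_ball hg h0 (fun w hw => by simpa [h1] using hb w hw) hv
    simp only [Function.const] at this
    rw [this, sub_self, norm_zero]
    positivity
  · have hne : ∀ w ∈ ball (0 : E) 1, 1 - conj (g 0) * g w ≠ 0 := fun w hw =>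
      one_sub_conj_mul_ne_zero h1 (hb w hw)
    -- Schwarz's lemma, after a disc automorphism has moved `g 0` to `0`.
    have key := Complex.norm_le_norm_of_mapsTo_ball
      (f := fun w => (g w - g 0) / (1 - conj (g 0) * g w)) (R := 1) (z := v)
      (by
        simp_rw [div_eq_mul_inv]
        exact (hg.sub_const _).mul
          (differentiableOn_inv.comp ((hg.const_mul _).const_sub _)
            fun w hw => Set.mem_compl_singleton_iff.2 (hne w hw)))
      (fun w hw => by
        rw [mem_closedBall_zero_iff, norm_div]
        exact div_le_one_of_le₀ (norm_sub_le_norm_one_sub_conj_mul h1.le (hb w hw))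
          (norm_nonneg _))
      (by simp) (mem_ball_zero_iff.1 hv)
    rwa [norm_div, div_le_iff₀ (norm_pos_iff.2 (hne v hv))] at key

/-- The disc automorphism `z ↦ (z + a) / (1 + conj a * z)`. -/
noncomputable def mobiusShift (a z : ℂ) : ℂ := (z + a) / (1 + conj a * z)

lemma one_add_conj_mul_ne_zero {a b : ℂ} (ha : ‖a‖ < 1) (hb : ‖b‖ ≤ 1) : 1 + conj a * b ≠ 0 := by
  simpa using one_sub_conj_mul_ne_zero (a := a) (b := -b) ha (by simpa using hb)

lemma norm_mobiusShift_lt_one {a z : ℂ} (ha : ‖a‖ < 1) (hz : ‖z‖ < 1) : ‖mobiusShift a z‖ < 1 := by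
  have h := norm_one_sub_conj_mul_sq (-a) z
  simp only [map_neg, neg_mul, sub_neg_eq_add, norm_neg] at h
  rw [mobiusShift, norm_div, div_lt_one (norm_pos_iff.2 (one_add_conj_mul_ne_zero ha hz.le))]
  refine lt_of_pow_lt_pow_left₀ 2 (norm_nonneg _) ?_
  rw [h]
  have := mul_pos (sub_pos.2 (pow_lt_one₀ (norm_nonneg a) ha two_ne_zero))
    (sub_pos.2 (pow_lt_one₀ (norm_nonneg z) hz two_ne_zero))
  linarith

lemma mobiusShift_zero (a : ℂ) : mobiusShift a 0 = a := by simp [mobiusShift]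

lemma mobiusShift_div {a z : ℂ} (ha : ‖a‖ < 1) (hz : ‖z‖ ≤ 1) :
    mobiusShift a ((z - a) / (1 - conj a * z)) = z := by
  have h1 := one_sub_conj_mul_ne_zero ha hz
  have h2 := one_sub_conj_mul_ne_zero ha ha.le
  have h3 : 1 + conj a * ((z - a) / (1 - conj a * z)) = (1 - conj a * a) / (1 - conj a * z) := by
    field_simp
    ring
  have h4 : (z - a) / (1 - conj a * z) + a = z * (1 - conj a * a) / (1 - conj a * z) := by
    rw [eq_div_iff h1, add_mul, div_mul_cancel₀ _ h1]
    ring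
  rw [mobiusShift, h3, h4, div_div_div_cancel_right₀ h1, mul_div_cancel_right₀ _ h2]

lemma differentiableOn_mobiusShift {a : ℂ} (ha : ‖a‖ < 1) :
    DifferentiableOn ℂ (mobiusShift a) (ball 0 1) :=
  (differentiableOn_id.add_const a).div ((differentiableOn_id.const_mul _).const_add _)
    fun _ hz => one_add_conj_mul_ne_zero ha (mem_ball_zero_iff.1 hz).le

/-- The **Schwarz–Pick lemma** on the bidisk. -/
lemma IsSchur.schwarzPick {φ : ℂ × ℂ → ℂ} (hφ : IsSchur φ) {p q : ℂ × ℂ} (hp : p ∈ bidisk)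
    (hq : q ∈ bidisk) {r : ℝ} (hr : r < 1) (h1 : ‖p.1 - q.1‖ ≤ r * ‖1 - conj q.1 * p.1‖)
    (h2 : ‖p.2 - q.2‖ ≤ r * ‖1 - conj q.2 * p.2‖) :
    ‖φ p - φ q‖ ≤ r * ‖1 - conj (φ q) * φ p‖ := by
  set m : ℂ × ℂ → ℂ × ℂ := fun v => (mobiusShift q.1 v.1, mobiusShift q.2 v.2) with hm
  have hball : ∀ v : ℂ × ℂ, v ∈ ball (0 : ℂ × ℂ) 1 ↔ ‖v.1‖ < 1 ∧ ‖v.2‖ < 1 := fun v => by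
    rw [mem_ball_zero_iff, Prod.norm_def, max_lt_iff]
  have hmaps : ∀ v ∈ ball (0 : ℂ × ℂ) 1, m v ∈ bidisk := fun v hv =>
    ⟨norm_mobiusShift_lt_one hq.1 ((hball v).1 hv).1,
      norm_mobiusShift_lt_one hq.2 ((hball v).1 hv).2⟩
  have hmd : DifferentiableOn ℂ m (ball 0 1) := by
    refine DifferentiableOn.prodMk ?_ ?_
    · exact (differentiableOn_mobiusShift hq.1).comp differentiable_fst.differentiableOn
        fun v hv => mem_ball_zero_iff.2 ((hball v).1 hv).1
    · exact (differentiableOn_mobiusShift hq.2).comp differentiable_snd.differentiableOn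
        fun v hv => mem_ball_zero_iff.2 ((hball v).1 hv).2
  set v : ℂ × ℂ := ((p.1 - q.1) / (1 - conj q.1 * p.1), (p.2 - q.2) / (1 - conj q.2 * p.2)) with hv
  have hmv : m v = p := Prod.ext (mobiusShift_div hq.1 hp.1.le) (mobiusShift_div hq.2 hp.2.le)
  have hm0 : m 0 = q := Prod.ext (mobiusShift_zero _) (mobiusShift_zero _)
  have hvr : ‖v‖ ≤ r := by
    rw [Prod.norm_def, max_le_iff, hv, norm_div, norm_div,
      div_le_iff₀ (norm_pos_iff.2 (one_sub_conj_mul_ne_zero hq.1 hp.1.le)),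
      div_le_iff₀ (norm_pos_iff.2 (one_sub_conj_mul_ne_zero hq.2 hp.2.le))]
    exact ⟨h1, h2⟩
  have := schwarzPick_zero (g := φ ∘ m) (hφ.1.comp hmd hmaps) (fun w hw => hφ.2 _ (hmaps w hw))
    (mem_ball_zero_iff.2 (hvr.trans_lt hr))
  simp only [Function.comp_apply, hmv, hm0] at this
  exact this.trans (mul_le_mul_of_nonneg_right hvr (norm_nonneg _))

/-- Schwarz–Pick with pseudohyperbolic distance `ρ` replaced by `1 / (1 - ρ ^ 2)`, so that `K`
corresponds to `r = √(1 - K⁻¹)`. This form survives `q` tending to the boundary, where `ρ → 1`. -/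
lemma IsSchur.norm_one_sub_conj_mul_sq_le {φ : ℂ × ℂ → ℂ} (hφ : IsSchur φ) {p q : ℂ × ℂ}
    (hp : p ∈ bidisk) (hq : q ∈ bidisk) {K : ℝ}
    (h1 : ‖1 - conj q.1 * p.1‖ ^ 2 ≤ K * ((1 - ‖q.1‖ ^ 2) * (1 - ‖p.1‖ ^ 2)))
    (h2 : ‖1 - conj q.2 * p.2‖ ^ 2 ≤ K * ((1 - ‖q.2‖ ^ 2) * (1 - ‖p.2‖ ^ 2))) :
    ‖1 - conj (φ q) * φ p‖ ^ 2 ≤ K * ((1 - ‖φ q‖ ^ 2) * (1 - ‖φ p‖ ^ 2)) := by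
  have hK : 1 ≤ K := by
    have hpos := mul_pos (sub_pos.2 (pow_lt_one₀ (norm_nonneg q.1) hq.1 two_ne_zero))
      (sub_pos.2 (pow_lt_one₀ (norm_nonneg p.1) hp.1 two_ne_zero))
    rw [norm_one_sub_conj_mul_sq] at h1
    nlinarith [sq_nonneg ‖p.1 - q.1‖]
  have hK0 : 0 < K := by linarith
  have hr0 : 0 ≤ 1 - K⁻¹ := sub_nonneg.2 (inv_le_one_of_one_le₀ hK)
  have aux : ∀ a b : ℂ, ‖1 - conj a * b‖ ^ 2 ≤ K * ((1 - ‖a‖ ^ 2) * (1 - ‖b‖ ^ 2)) ↔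
      ‖b - a‖ ^ 2 ≤ (1 - K⁻¹) * ‖1 - conj a * b‖ ^ 2 := by
    intro a b
    rw [← inv_mul_le_iff₀ hK0]
    have := norm_one_sub_conj_mul_sq a b
    constructor <;> intro h <;> linarith
  have aux2 : ∀ a b : ℂ, ‖1 - conj a * b‖ ^ 2 ≤ K * ((1 - ‖a‖ ^ 2) * (1 - ‖b‖ ^ 2)) ↔
      ‖b - a‖ ≤ √(1 - K⁻¹) * ‖1 - conj a * b‖ := by
    intro a b
    rw [aux, ← sq_le_sq₀ (norm_nonneg _) (by positivity), mul_pow, Real.sq_sqrt hr0]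
  rw [aux2] at h1 h2 ⊢
  refine hφ.schwarzPick hp hq ?_ h1 h2
  rw [Real.sqrt_lt' one_pos]
  linarith [inv_pos.2 hK0]

/-! ### Julia–Carathéodory on the disc -/

/-- A **Harnack inequality** for holomorphic functions with nonnegative real part. -/
lemma norm_le_of_re_nonneg {P : ℂ → ℂ} {c z : ℂ} {R : ℝ} (hP : DifferentiableOn ℂ P (ball c R))
    (hre : ∀ w ∈ ball c R, 0 ≤ (P w).re) (hz : z ∈ ball c R) :
    ‖P z‖ ≤ ‖P c‖ * ((R + ‖z - c‖) / (R - ‖z - c‖)) := by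
  have hzR : ‖z - c‖ < R := mem_ball_iff_norm.1 hz
  have hR : 0 < R := (norm_nonneg _).trans_lt hzR
  have hmaps : ∀ w ∈ ball (0 : ℂ) R, c + w ∈ ball c R := fun w hw => by
    simpa [mem_ball_iff_norm] using hw
  -- Borel–Carathéodory for `-P`, whose real part lies below every `M > 0`; then `M → 0`.
  have key : ∀ M : ℝ, 0 < M → ‖P z‖ ≤
      2 * M * ‖z - c‖ / (R - ‖z - c‖) + ‖P c‖ * (R + ‖z - c‖) / (R - ‖z - c‖) := by
    intro M hM
    have := Complex.borelCaratheodory (f := fun w => -P (c + w)) (z := z - c) hM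
      ((hP.comp ((differentiableOn_const c).add differentiableOn_id) hmaps).neg)
      (fun w hw => by
        have := hre _ (hmaps w hw)
        simp only [Set.mem_ofPred_eq, Complex.neg_re]
        linarith) hR (by simpa using hzR)
    simpa using this
  have hlim : Tendsto (fun M : ℝ => 2 * M * ‖z - c‖ / (R - ‖z - c‖) +
      ‖P c‖ * (R + ‖z - c‖) / (R - ‖z - c‖)) (𝓝[>] 0)
      (𝓝 (2 * 0 * ‖z - c‖ / (R - ‖z - c‖) + ‖P c‖ * (R + ‖z - c‖) / (R - ‖z - c‖))) := by
    refine Tendsto.mono_left (Continuous.tendsto ?_ 0) nhdsWithin_le_nhds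
    fun_prop
  have := ge_of_tendsto hlim (eventually_nhdsWithin_of_forall key)
  simpa [mul_div_assoc] using this

lemma norm_one_sub_real_mul_sq (d : ℂ) (t : ℝ) :
    ‖1 - t * d‖ ^ 2 = 1 - 2 * t * d.re + t ^ 2 * ‖d‖ ^ 2 := by
  simp only [Complex.sq_norm, Complex.normSq_apply, Complex.sub_re, Complex.sub_im, Complex.mul_re,
    Complex.mul_im, Complex.ofReal_re, Complex.ofReal_im, Complex.one_re, Complex.one_im]
  ring

/-- Segments leaving `1` into the left half-plane start inside the unit disc, quantitatively. -/
lemma eventually_le_one_sub_norm_sq {d : ℂ} (hd : 0 < d.re) :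
    ∀ᶠ t : ℝ in 𝓝[>] 0, 0 < t ∧ t * d.re ≤ 1 - ‖1 - t * d‖ ^ 2 := by
  have hd2 : 0 < ‖d‖ ^ 2 := pow_pos (norm_pos_iff.2 fun h => by simp [h] at hd) 2
  filter_upwards [Ioo_mem_nhdsGT (div_pos hd hd2)] with t ht
  refine ⟨ht.1, ?_⟩
  have := (lt_div_iff₀ hd2).1 ht.2
  rw [norm_one_sub_real_mul_sq]
  nlinarith [ht.1]

lemma eventually_one_sub_mul_mem_ball {d : ℂ} (hd : 0 < d.re) :
    ∀ᶠ t : ℝ in 𝓝[>] 0, (1 - t * d : ℂ) ∈ ball (0 : ℂ) 1 := by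
  filter_upwards [eventually_le_one_sub_norm_sq hd] with t ht
  rw [mem_ball_zero_iff]
  have := mul_pos ht.1 hd
  exact lt_of_pow_lt_pow_left₀ 2 zero_le_one (by linarith [ht.2])

/-- The radial case of the Julia–Carathéodory theorem on the disc. -/
lemma tendsto_radial_of_julia {f : ℂ → ℂ} {a : ℝ}
    (hb : ∀ z ∈ ball (0 : ℂ) 1, ‖f z‖ ≤ 1)
    (hJ : ∀ z ∈ ball (0 : ℂ) 1, ‖1 - f z‖ ^ 2 * (1 - ‖z‖ ^ 2) ≤
      a * ‖1 - z‖ ^ 2 * (1 - ‖f z‖ ^ 2))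
    (hl : ∀ b < a, ∀ᶠ t : ℝ in 𝓝[>] 0, b < (1 - ‖f (1 - t)‖) / t) (ha : 0 ≤ a) :
    Tendsto (fun t : ℝ => (1 - f (1 - t)) / t) (𝓝[>] 0) (𝓝 (a : ℂ)) := by
  have hball := eventually_one_sub_mul_mem_ball (d := 1) (by simp)
  simp only [mul_one] at hball
  have hpos : ∀ᶠ t : ℝ in 𝓝[>] 0, 0 < t := eventually_mem_nhdsWithin
  have hlow : ∀ t : ℝ, 0 < t → (1 - ‖f (1 - t)‖) / t ≤ ((1 - f (1 - t)) / t).re := fun t ht => by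
    rw [Complex.div_ofReal_re]
    gcongr
    rw [Complex.sub_re, Complex.one_re]
    exact sub_le_sub_left (Complex.re_le_norm _) _
  have hup : ∀ᶠ t : ℝ in 𝓝[>] 0, ‖(1 - f (1 - t)) / t‖ ≤ 2 * a / (2 - t) := by
    filter_upwards [hball, hpos, Ioo_mem_nhdsGT one_pos] with t ht ht0 ht1
    have hj := hJ _ ht
    have hn : ‖(1 - t : ℂ)‖ = 1 - t := by
      rw [← Complex.ofReal_one, ← Complex.ofReal_sub, Complex.norm_real, Real.norm_of_nonneg]
      linarith [ht1.2]
    have h1 : 1 - ‖f (1 - t)‖ ≤ ‖1 - f (1 - t)‖ := by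
      simpa using norm_sub_norm_le 1 (f (1 - t))
    have h2 := hb _ ht
    rw [norm_div, Complex.norm_real, Real.norm_of_nonneg ht0.le,
      div_le_div_iff₀ ht0 (by linarith [ht1.2])]
    rw [hn, sub_sub_cancel, Complex.norm_real, Real.norm_of_nonneg ht0.le] at hj
    set x := ‖1 - f (1 - t)‖
    set y := ‖f (1 - t)‖
    rcases (norm_nonneg _ : 0 ≤ x).eq_or_lt with hx | hx
    · have hx0 : x = 0 := hx.symm
      rw [hx0, zero_mul]
      positivity
    · have h3 : 1 - y ^ 2 ≤ 2 * x := by nlinarith [sq_nonneg (1 - y)]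
      have h4 : a * t ^ 2 * (1 - y ^ 2) ≤ a * t ^ 2 * (2 * x) := by gcongr
      refine le_of_mul_le_mul_left ?_ (mul_pos hx ht0)
      nlinarith
  have hupl : Tendsto (fun t : ℝ => 2 * a / (2 - t)) (𝓝[>] 0) (𝓝 a) := by
    have : ContinuousAt (fun t : ℝ => 2 * a / (2 - t)) 0 := by
      fun_prop (disch := norm_num)
    simpa using this.tendsto.mono_left nhdsWithin_le_nhds
  have hre : Tendsto (fun t : ℝ => ((1 - f (1 - t)) / t).re) (𝓝[>] 0) (𝓝 a) := by
    rw [tendsto_order]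
    refine ⟨fun b hba => ?_, fun b hab => ?_⟩
    · filter_upwards [hl b hba, hpos] with t h1 h2 using h1.trans_le (hlow t h2)
    · filter_upwards [hup, hupl.eventually_lt_const hab] with t h1 h2
      exact ((Complex.re_le_norm _).trans h1).trans_lt h2
  -- Real part tending to `a` and modulus asymptotically at most `a` leave no room for an imaginary
  -- part: expand the square.
  have hsq : Tendsto (fun t : ℝ => ‖(1 - f (1 - t)) / t - a‖ ^ 2) (𝓝[>] 0) (𝓝 0) := by
    have hlim : Tendsto (fun t : ℝ => (2 * a / (2 - t)) ^ 2 - 2 * a * ((1 - f (1 - t)) / t).re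
        + a ^ 2) (𝓝[>] 0) (𝓝 (a ^ 2 - 2 * a * a + a ^ 2)) :=
      ((hupl.pow 2).sub (hre.const_mul _)).add_const _
    rw [show a ^ 2 - 2 * a * a + a ^ 2 = 0 by ring] at hlim
    refine squeeze_zero' (Eventually.of_forall fun _ => by positivity) ?_ hlim
    filter_upwards [hup] with t ht
    have h1 : ‖(1 - f (1 - t)) / t - a‖ ^ 2 =
        ‖(1 - f (1 - t)) / t‖ ^ 2 - 2 * a * ((1 - f (1 - t)) / t).re + a ^ 2 := by
      generalize (1 - f (1 - t)) / t = w
      simp only [Complex.sq_norm, Complex.normSq_apply, Complex.sub_re, Complex.sub_im,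
        Complex.ofReal_re, Complex.ofReal_im]
      ring
    rw [h1]
    gcongr
  rw [tendsto_iff_norm_sub_tendsto_zero]
  simpa using hsq.sqrt

/-- The **Julia–Carathéodory theorem** on the disc, along segments ending at `1`. -/
lemma tendsto_of_julia {f : ℂ → ℂ} {a : ℝ} (hf : DifferentiableOn ℂ f (ball 0 1))
    (hb : ∀ z ∈ ball (0 : ℂ) 1, ‖f z‖ ≤ 1)
    (hJ : ∀ z ∈ ball (0 : ℂ) 1, ‖1 - f z‖ ^ 2 * (1 - ‖z‖ ^ 2) ≤
      a * ‖1 - z‖ ^ 2 * (1 - ‖f z‖ ^ 2))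
    (hl : ∀ b < a, ∀ᶠ t : ℝ in 𝓝[>] 0, b < (1 - ‖f (1 - t)‖) / t) (ha : 0 ≤ a)
    {d : ℂ} (hd : 0 < d.re) :
    Tendsto (fun t : ℝ => (1 - f (1 - t * d)) / t) (𝓝[>] 0) (𝓝 (a * d)) := by
  have hrad := tendsto_radial_of_julia hb hJ hl ha
  have hpos : ∀ᶠ t : ℝ in 𝓝[>] 0, 0 < t := eventually_mem_nhdsWithin
  have hd0 : d ≠ 0 := fun h => by simp [h] at hd
  have hz2 : ∀ z ∈ ball (0 : ℂ) 1, 0 < 1 - ‖z‖ ^ 2 := fun z hz =>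
    sub_pos.2 (pow_lt_one₀ (norm_nonneg z) (mem_ball_zero_iff.1 hz) two_ne_zero)
  rcases ha.eq_or_lt with rfl | ha
  · have hone : ∀ z ∈ ball (0 : ℂ) 1, 1 - f z = 0 := fun z hz => by
      have := hJ z hz
      rw [zero_mul, zero_mul] at this
      have h2 : ‖1 - f z‖ ^ 2 ≤ 0 := nonpos_of_mul_nonpos_left this (hz2 z hz)
      exact norm_eq_zero.1 (pow_eq_zero_iff two_ne_zero |>.1 (le_antisymm h2 (by positivity)))
    refine Tendsto.congr' ?_ (by simpa using tendsto_const_nhds)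
    filter_upwards [eventually_one_sub_mul_mem_ball hd] with t ht
    rw [hone _ ht, zero_div]
  have hf1 : ∀ z ∈ ball (0 : ℂ) 1, 1 - f z ≠ 0 := fun z hz h => by
    have hz1 : f z = 1 := (sub_eq_zero.1 h).symm
    have hconst := Complex.eqOn_of_isPreconnected_of_isMaxOn_norm
      (convex_ball (0 : ℂ) 1).isPreconnected isOpen_ball hf hz
      (fun w hw => by simpa [hz1] using hb w hw)
    have hball := eventually_one_sub_mul_mem_ball (d := 1) (by simp)
    simp only [mul_one] at hball
    obtain ⟨t, h1, h2⟩ := ((hl 0 ha).and hball).exists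
    rw [hconst h2] at h1
    simp [Function.const, hz1] at h1
  have hz1 : ∀ z ∈ ball (0 : ℂ) 1, 1 - z ≠ 0 := fun z hz h => by
    rw [← sub_eq_zero.1 h] at hz
    simp at hz
  -- `2 / (1 - w) - 1` is the Cayley transform `(1 + w) / (1 - w)`; under it Julia's inequality says
  -- exactly that `P` has nonnegative real part.
  set P : ℂ → ℂ := fun z => (2 / (1 - f z) - 1) - (a : ℂ)⁻¹ * (2 / (1 - z) - 1) with hPdef
  have hP : DifferentiableOn ℂ P (ball 0 1) :=
    ((((differentiableOn_const 2).div (hf.const_sub 1) hf1)).sub_const 1).sub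
      ((((differentiableOn_const 2).div (differentiableOn_id.const_sub 1) hz1).sub_const 1).const_mul _)
  have hcay : ∀ w : ℂ, 1 - w ≠ 0 → (2 / (1 - w) - 1).re = (1 - ‖w‖ ^ 2) / ‖1 - w‖ ^ 2 := by
    intro w hw
    have h1 : ‖1 - w‖ ^ 2 ≠ 0 := by positivity
    rw [eq_div_iff h1]
    rw [Complex.sub_re, Complex.div_re]
    simp only [Complex.sq_norm] at h1 ⊢
    field_simp
    simp [Complex.normSq_apply]
    ring
  have hre : ∀ z ∈ ball (0 : ℂ) 1, 0 ≤ (P z).re := by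
    intro z hz
    simp only [hPdef]
    rw [Complex.sub_re, ← Complex.ofReal_inv, Complex.re_ofReal_mul, hcay _ (hf1 z hz),
      hcay _ (hz1 z hz), sub_nonneg, inv_mul_le_iff₀ ha, ← mul_div_assoc,
      div_le_div_iff₀ (pow_pos (norm_pos_iff.2 (hz1 z hz)) 2)
        (pow_pos (norm_pos_iff.2 (hf1 z hz)) 2)]
    linarith [hJ z hz]
  -- Chosen so that `‖R - d‖ ^ 2 = R ^ 2 - ‖d‖ ^ 2`; hence `1 - t * d` lies in the disc of centre `1
  -- - t * R` and radius `t * R`.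
  set R : ℝ := ‖d‖ ^ 2 / d.re with hR
  have hRpos : 0 < R := div_pos (pow_pos (norm_pos_iff.2 hd0) 2) hd
  have hRd : ‖(R : ℂ) - d‖ < R := by
    refine lt_of_pow_lt_pow_left₀ 2 hRpos.le ?_
    have h1 : ‖(R : ℂ) - d‖ ^ 2 = R ^ 2 - 2 * R * d.re + ‖d‖ ^ 2 := by
      simp only [Complex.sq_norm, Complex.normSq_apply, Complex.sub_re, Complex.sub_im,
        Complex.ofReal_re, Complex.ofReal_im]
      ring
    have h2 : R * d.re = ‖d‖ ^ 2 := div_mul_cancel₀ _ hd.ne'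
    nlinarith [pow_pos (norm_pos_iff.2 hd0) 2]
  have hRt : Tendsto (fun t : ℝ => t * R) (𝓝[>] 0) (𝓝[>] 0) := by
    refine tendsto_nhdsWithin_iff.2 ⟨?_, ?_⟩
    · exact (by fun_prop : Continuous fun t : ℝ => t * R).tendsto' 0 0 (by simp)
        |>.mono_left nhdsWithin_le_nhds
    · filter_upwards [hpos] with t ht using mul_pos ht hRpos
  have ha' : (a : ℂ) ≠ 0 := by exact_mod_cast ha.ne'
  have hPrad : Tendsto (fun t : ℝ => (t : ℂ) * P (1 - t)) (𝓝[>] 0) (𝓝 0) := by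
    have ht0 : Tendsto (fun t : ℝ => (t : ℂ)) (𝓝[>] 0) (𝓝 0) :=
      (Complex.continuous_ofReal.tendsto' 0 0 (by simp)).mono_left nhdsWithin_le_nhds
    have h1 : Tendsto (fun t : ℝ => 2 * ((1 - f (1 - t)) / t)⁻¹ - t - (a : ℂ)⁻¹ * (2 - t)) (𝓝[>] 0)
        (𝓝 (2 * (a : ℂ)⁻¹ - 0 - (a : ℂ)⁻¹ * (2 - 0))) :=
      (((hrad.inv₀ ha').const_mul 2).sub ht0).sub ((ht0.const_sub 2).const_mul _)
    rw [show 2 * (a : ℂ)⁻¹ - 0 - (a : ℂ)⁻¹ * (2 - 0) = 0 by ring] at h1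
    refine h1.congr' ?_
    filter_upwards [hpos] with t ht
    have : (t : ℂ) ≠ 0 := by exact_mod_cast ht.ne'
    simp only [hPdef, sub_sub_cancel, inv_div]
    field_simp
  -- Harnack carries the radial decay to the segment: by scaling, its constant does not depend on
  -- `t`. The factor `R⁻¹` in `C` appears because the centre is the radial point with parameter `t *
  -- R`.
  have hPd : Tendsto (fun t : ℝ => (t : ℂ) * P (1 - t * d)) (𝓝[>] 0) (𝓝 0) := by
    set C := R⁻¹ * ((R + ‖(R : ℂ) - d‖) / (R - ‖(R : ℂ) - d‖)) with hC
    have h1 := ((hPrad.comp hRt).norm).mul_const C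
    simp only [norm_zero, zero_mul] at h1
    refine squeeze_zero_norm' ?_ h1
    filter_upwards [hpos, hRt.eventually (Ioo_mem_nhdsGT one_pos)] with t ht hRt1
    have hn : ‖((1 - t * d : ℂ)) - (1 - (t * R : ℝ))‖ = t * ‖(R : ℂ) - d‖ := by
      rw [show ((1 - t * d : ℂ)) - (1 - (t * R : ℝ)) = t * (R - d) by push_cast; ring, norm_mul,
        Complex.norm_real, Real.norm_of_nonneg ht.le]
    have hsub : ball ((1 - (t * R : ℝ)) : ℂ) (t * R) ⊆ ball 0 1 := by
      refine ball_subset_ball' ?_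
      rw [dist_zero_right, ← Complex.ofReal_one, ← Complex.ofReal_sub, Complex.norm_real,
        Real.norm_of_nonneg (by linarith [hRt1.2])]
      linarith
    have hk := norm_le_of_re_nonneg (z := 1 - t * d) (hP.mono hsub) (fun w hw => hre w (hsub hw))
      (by rw [mem_ball_iff_norm, hn]; gcongr)
    rw [hn, ← mul_add, ← mul_sub, mul_div_mul_left _ _ ht.ne'] at hk
    simp only [Function.comp_apply, norm_mul, Complex.norm_real, Real.norm_of_nonneg ht.le,
      Real.norm_of_nonneg hRpos.le]
    calc t * ‖P (1 - t * d)‖ ≤ t * _ := mul_le_mul_of_nonneg_left hk ht.le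
      _ = _ := by
        rw [hC]
        field_simp
  have ht0 : Tendsto (fun t : ℝ => (t : ℂ)) (𝓝[>] 0) (𝓝 0) :=
    (Complex.continuous_ofReal.tendsto' 0 0 (by simp)).mono_left nhdsWithin_le_nhds
  -- The definition of `P` at `1 - t * d`, solved for `(1 - f) / t`.
  have h1 : Tendsto (fun t : ℝ => ((t * P (1 - t * d) + t + (a : ℂ)⁻¹ * (2 / d - t)) / 2)⁻¹)
      (𝓝[>] 0) (𝓝 (((0 + 0 + (a : ℂ)⁻¹ * (2 / d - 0)) / 2)⁻¹)) := by
    refine Tendsto.inv₀ ?_ ?_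
    · exact ((hPd.add ht0).add ((ht0.const_sub _).const_mul _)).div_const _
    · simp [ha', hd0]
  rw [show ((0 + 0 + (a : ℂ)⁻¹ * (2 / d - 0)) / 2)⁻¹ = a * d by
    field_simp; simp] at h1
  refine h1.congr' ?_
  filter_upwards [hpos, eventually_one_sub_mul_mem_ball hd] with t ht htb
  have ht' : (t : ℂ) ≠ 0 := by exact_mod_cast ht.ne'
  rw [← inv_div (t : ℂ) (1 - f (1 - t * d))]
  congr 1
  have e : (t : ℂ) * (2 / (t * d)) = 2 / d := by field_simp
  simp only [hPdef, sub_sub_cancel]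
  linear_combination (-(a : ℂ)⁻¹ / 2) * e

/-! ### Julia's inequality on the bidisk and the nontangential limit -/

lemma norm_lt_one_of_mem_bidisk {p : ℂ × ℂ} (hp : p ∈ bidisk) : ‖p‖ < 1 :=
  max_lt hp.1 hp.2

lemma IsSchur.quotient_nonneg {φ : ℂ × ℂ → ℂ} (hφ : IsSchur φ) {p : ℂ × ℂ} (hp : p ∈ bidisk) :
    0 ≤ (1 - ‖φ p‖) / (1 - ‖p‖) :=
  div_nonneg (sub_nonneg.2 (hφ.2 p hp)) (sub_nonneg.2 (norm_lt_one_of_mem_bidisk hp).le)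

lemma IsSchur.caratheodoryLiminf_nonneg {φ : ℂ × ℂ → ℂ} (hφ : IsSchur φ) (τ : ℂ × ℂ) :
    0 ≤ caratheodoryLiminf φ τ :=
  le_liminf_of_le (h := eventually_nhdsWithin_of_forall fun _ hp =>
    EReal.coe_nonneg.2 (hφ.quotient_nonneg hp))

lemma norm_one_sub_conj_mul_of_norm_eq_one {a b : ℂ} (ha : ‖a‖ = 1) : ‖1 - conj a * b‖ = ‖a - b‖ := by
  have h : conj a * a = 1 := by rw [Complex.conj_mul', ha]; simp
  rw [show 1 - conj a * b = conj a * (a - b) by rw [mul_sub, h], norm_mul, RCLike.norm_conj, ha,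
    one_mul]

/-- The lower limit at a `B`-point is attained along an ultrafilter along which `φ` converges. -/
lemma IsSchur.exists_ultrafilter {φ : ℂ × ℂ → ℂ} (hφ : IsSchur φ) {τ : ℂ × ℂ} {a : ℝ}
    (ha : caratheodoryLiminf φ τ = a) :
    ∃ (U : Ultrafilter (ℂ × ℂ)) (ω : ℂ), ↑U ≤ 𝓝[bidisk] τ ∧
      Tendsto (fun p => (1 - ‖φ p‖) / (1 - ‖p‖)) U (𝓝 a) ∧ Tendsto φ U (𝓝 ω) := by
  have hcl : MapClusterPt (a : EReal) (𝓝[bidisk] τ)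
      (fun p : ℂ × ℂ => (((1 - ‖φ p‖) / (1 - ‖p‖) : ℝ) : EReal)) := by
    rw [mapClusterPt_iff_frequently]
    intro s hs
    obtain ⟨l, u, hlu, hsub⟩ := (mem_nhds_iff_exists_Ioo_subset'
      ⟨⊥, EReal.bot_lt_coe a⟩ ⟨⊤, EReal.coe_lt_top a⟩).1 hs
    have h1 := frequently_lt_of_liminf_lt (hu := by isBoundedDefault) (ha.trans_lt hlu.2)
    have h2 := eventually_lt_of_lt_liminf (hlu.1.trans_eq ha.symm)
    exact (h1.and_eventually h2).mono fun p hp => hsub ⟨hp.2, hp.1⟩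
  obtain ⟨U, hU, hlim⟩ := mapClusterPt_iff_ultrafilter.1 hcl
  have hmem : ∀ᶠ p in (U : Filter (ℂ × ℂ)), p ∈ bidisk := hU eventually_mem_nhdsWithin
  obtain ⟨ω, -, hω⟩ := (isCompact_closedBall (0 : ℂ) 1).ultrafilter_le_nhds (U.map φ) (by
    rw [le_principal_iff]
    exact hmem.mono fun p hp => mem_closedBall_zero_iff.2 (hφ.2 p hp))
  exact ⟨U, ω, hU, EReal.tendsto_coe.1 hlim, hω⟩

/-- **Julia's inequality** on the bidisk at a boundary point in `𝕋 × 𝔻`. -/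
lemma IsSchur.exists_julia {φ : ℂ × ℂ → ℂ} (hφ : IsSchur φ) {τ : ℂ × ℂ} (hτ₁ : ‖τ.1‖ = 1)
    (hτ₂ : ‖τ.2‖ < 1) {a : ℝ} (ha : caratheodoryLiminf φ τ = a) :
    ∃ ω : ℂ, ‖ω‖ = 1 ∧ ∀ p ∈ bidisk,
      ‖ω - φ p‖ ^ 2 * (1 - ‖p.1‖ ^ 2) ≤ a * ‖τ.1 - p.1‖ ^ 2 * (1 - ‖φ p‖ ^ 2) := by
  obtain ⟨U, ω, hU, hu, hω⟩ := hφ.exists_ultrafilter ha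
  have hmem : ∀ᶠ p in (U : Filter (ℂ × ℂ)), p ∈ bidisk := hU eventually_mem_nhdsWithin
  have hUτ : (U : Filter (ℂ × ℂ)) ≤ 𝓝 τ := hU.trans nhdsWithin_le_nhds
  have hfst : Tendsto (fun q : ℂ × ℂ => q.1) U (𝓝 τ.1) := (continuous_fst.tendsto τ).mono_left hUτ
  have hsnd : Tendsto (fun q : ℂ × ℂ => q.2) U (𝓝 τ.2) := (continuous_snd.tendsto τ).mono_left hUτ
  have hnorm : ∀ᶠ q in (U : Filter (ℂ × ℂ)), ‖q‖ = ‖q.1‖ := by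
    filter_upwards [hsnd.norm.eventually_lt hfst.norm (hτ₂.trans_eq hτ₁.symm)] with q hq
    exact max_eq_left hq.le
  have hone : Tendsto (fun q => 1 - ‖φ q‖) U (𝓝 0) := by
    have h1 := hu.mul (hfst.norm.const_sub 1)
    rw [hτ₁, sub_self, mul_zero] at h1
    refine h1.congr' ?_
    filter_upwards [hnorm, hmem] with q hq hqm
    rw [hq, div_mul_cancel₀ _ (sub_pos.2 hqm.1).ne']
  have hω1 : ‖ω‖ = 1 := by
    have := tendsto_nhds_unique hone (hω.norm.const_sub 1)
    linarith
  refine ⟨ω, hω1, fun p hp => ?_⟩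
  have hp1 : 0 < 1 - ‖p.1‖ ^ 2 := sub_pos.2 (pow_lt_one₀ (norm_nonneg _) hp.1 two_ne_zero)
  have hp2 : 0 < 1 - ‖p.2‖ ^ 2 := sub_pos.2 (pow_lt_one₀ (norm_nonneg _) hp.2 two_ne_zero)
  have ht2 : 0 < 1 - ‖τ.2‖ ^ 2 := sub_pos.2 (pow_lt_one₀ (norm_nonneg _) hτ₂ two_ne_zero)
  have hφp : 0 ≤ 1 - ‖φ p‖ ^ 2 := sub_nonneg.2 (pow_le_one₀ (norm_nonneg _) (hφ.2 p hp))
  -- Schwarz–Pick with `K = X + Y`, the sum of the two coordinate ratios in place of their maximum.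
  -- The blow-up of `X` is absorbed by the difference quotient; `Y` stays bounded and meets `1 - ‖φ
  -- q‖ → 0`.
  have hbound : ∀ᶠ q in (U : Filter (ℂ × ℂ)), ‖1 - conj (φ q) * φ p‖ ^ 2 ≤
      ((1 - ‖φ q‖) / (1 - ‖q‖) * (1 + ‖φ q‖) *
          (‖1 - conj q.1 * p.1‖ ^ 2 / ((1 + ‖q.1‖) * (1 - ‖p.1‖ ^ 2))) +
        (1 - ‖φ q‖) * (1 + ‖φ q‖) *
          (‖1 - conj q.2 * p.2‖ ^ 2 / ((1 - ‖q.2‖ ^ 2) * (1 - ‖p.2‖ ^ 2)))) *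
        (1 - ‖φ p‖ ^ 2) := by
    filter_upwards [hnorm, hmem] with q hq hqm
    have hq1 : 0 < 1 - ‖q.1‖ ^ 2 := sub_pos.2 (pow_lt_one₀ (norm_nonneg _) hqm.1 two_ne_zero)
    have hq2 : 0 < 1 - ‖q.2‖ ^ 2 := sub_pos.2 (pow_lt_one₀ (norm_nonneg _) hqm.2 two_ne_zero)
    set X := ‖1 - conj q.1 * p.1‖ ^ 2 / ((1 - ‖q.1‖ ^ 2) * (1 - ‖p.1‖ ^ 2)) with hX
    set Y := ‖1 - conj q.2 * p.2‖ ^ 2 / ((1 - ‖q.2‖ ^ 2) * (1 - ‖p.2‖ ^ 2)) with hY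
    have hX0 : 0 ≤ X := by positivity
    have hY0 : 0 ≤ Y := by positivity
    have key := hφ.norm_one_sub_conj_mul_sq_le hp hqm (K := X + Y)
      ((div_le_iff₀ (mul_pos hq1 hp1)).1 (by linarith))
      ((div_le_iff₀ (mul_pos hq2 hp2)).1 (by linarith))
    refine key.trans_eq ?_
    rw [← mul_assoc]
    congr 1
    have h3 : 1 - ‖q.1‖ ≠ 0 := (sub_pos.2 hqm.1).ne'
    have h4 : 1 + ‖q.1‖ ≠ 0 := by positivity
    rw [hq, hX, show 1 - ‖q.1‖ ^ 2 = (1 - ‖q.1‖) * (1 + ‖q.1‖) by ring]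
    field_simp
    ring
  have hc : ∀ (z : ℂ) {f : ℂ × ℂ → ℂ} {w : ℂ}, Tendsto f U (𝓝 w) →
      Tendsto (fun q => ‖1 - conj (f q) * z‖ ^ 2) U (𝓝 (‖1 - conj w * z‖ ^ 2)) := fun z f w h =>
    ((((Complex.continuous_conj.tendsto w).comp h).mul_const z).const_sub 1).norm.pow 2
  have hlim := le_of_tendsto_of_tendsto (hc (φ p) hω)
    ((((hu.mul (hω.norm.const_add 1)).mul
      ((hc p.1 hfst).div ((hfst.norm.const_add 1).mul_const (1 - ‖p.1‖ ^ 2)) (by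
        rw [hτ₁]; positivity))).add
      ((hone.mul (hω.norm.const_add 1)).mul
        ((hc p.2 hsnd).div (((hsnd.norm.pow 2).const_sub 1).mul_const (1 - ‖p.2‖ ^ 2))
          (by positivity)))).mul_const (1 - ‖φ p‖ ^ 2)) hbound
  rw [norm_one_sub_conj_mul_of_norm_eq_one hω1, norm_one_sub_conj_mul_of_norm_eq_one hτ₁, hω1,
    hτ₁] at hlim
  rw [← le_div_iff₀ hp1]
  refine hlim.trans_eq ?_
  field_simp
  ring

/-- A consequence of Julia's inequality that controls the boundary behaviour. -/
lemma norm_sub_mul_le_of_julia {ω v : ℂ} {A B : ℝ} (hω : ‖ω‖ = 1)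
    (hA : 0 ≤ A) (h : ‖ω - v‖ ^ 2 * B ≤ A * (1 - ‖v‖ ^ 2)) : ‖ω - v‖ * B ≤ 2 * A := by
  have h1 : 1 - ‖v‖ ≤ ‖ω - v‖ := hω ▸ norm_sub_norm_le ω v
  rcases (norm_nonneg (ω - v)).eq_or_lt with h0 | h0
  · rw [← h0]
    linarith
  · have h2 : 1 - ‖v‖ ^ 2 ≤ 2 * ‖ω - v‖ := by nlinarith [sq_nonneg (1 - ‖v‖)]
    refine le_of_mul_le_mul_left ?_ h0
    nlinarith [mul_le_mul_of_nonneg_left h2 hA]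

/-- Julia's inequality bounds `‖ω - φ p‖` by `2 * a * ‖τ.1 - p.1‖ ^ 2 / (1 - ‖p.1‖ ^ 2)`;
nontangential approach cancels one factor against the denominator. -/
lemma hasNontangentialLimit_of_julia {φ : ℂ × ℂ → ℂ} {τ : ℂ × ℂ} {a : ℝ}
    (ha : 0 ≤ a) {ω : ℂ} (hω : ‖ω‖ = 1) (hJ : ∀ p ∈ bidisk,
      ‖ω - φ p‖ ^ 2 * (1 - ‖p.1‖ ^ 2) ≤ a * ‖τ.1 - p.1‖ ^ 2 * (1 - ‖φ p‖ ^ 2)) :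
    HasNontangentialLimit φ τ ω := by
  rintro S ⟨hS, -, c, hc⟩
  rw [tendsto_iff_norm_sub_tendsto_zero]
  have hlim : Tendsto (fun p : ℂ × ℂ => 2 * a * |c| * ‖τ - p‖) (𝓝[S] τ) (𝓝 0) :=
    ((by fun_prop : Continuous fun p : ℂ × ℂ => 2 * a * |c| * ‖τ - p‖).tendsto' τ 0
      (by simp)).mono_left nhdsWithin_le_nhds
  refine squeeze_zero' (Eventually.of_forall fun _ => norm_nonneg _) ?_ hlim
  filter_upwards [eventually_mem_nhdsWithin] with p hp
  have hpb := hS hp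
  have h1 := norm_sub_mul_le_of_julia hω (by positivity) (hJ p hpb)
  have h2 : 0 < 1 - ‖p.1‖ ^ 2 := sub_pos.2 (pow_lt_one₀ (norm_nonneg _) hpb.1 two_ne_zero)
  have h3 : ‖τ.1 - p.1‖ ≤ ‖τ - p‖ := norm_fst_le (τ - p)
  have h4 : ‖τ.1 - p.1‖ ≤ |c| * (1 - ‖p.1‖ ^ 2) := by
    have h5 : ‖p.1‖ ≤ ‖p‖ := norm_fst_le p
    calc ‖τ.1 - p.1‖ ≤ c * (1 - ‖p‖) := h3.trans (hc p hp)
      _ ≤ |c| * (1 - ‖p‖) := mul_le_mul_of_nonneg_right (le_abs_self c)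
          (sub_nonneg.2 (norm_lt_one_of_mem_bidisk hpb).le)
      _ ≤ |c| * (1 - ‖p.1‖ ^ 2) := mul_le_mul_of_nonneg_left
          (by nlinarith [norm_nonneg p.1, hpb.1]) (abs_nonneg c)
  rw [norm_sub_rev]
  refine le_of_mul_le_mul_right (h1.trans ?_) h2
  calc 2 * (a * ‖τ.1 - p.1‖ ^ 2) = 2 * a * (‖τ.1 - p.1‖ * ‖τ.1 - p.1‖) := by ring
    _ ≤ 2 * a * (|c| * (1 - ‖p.1‖ ^ 2) * ‖τ - p‖) := by gcongr
    _ = _ := by ring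

/-! ### Directional derivatives -/

/-- The directional derivative of a slice with frozen second variable. -/
lemma tendsto_slice_of_julia {φ : ℂ × ℂ → ℂ} (hφ : IsSchur φ) {τ : ℂ × ℂ} (hτ₁ : ‖τ.1‖ = 1)
    (hτ₂ : ‖τ.2‖ < 1) {a : ℝ} (ha : caratheodoryLiminf φ τ = a) {ω : ℂ} (hω : ‖ω‖ = 1)
    (hJ : ∀ p ∈ bidisk,
      ‖ω - φ p‖ ^ 2 * (1 - ‖p.1‖ ^ 2) ≤ a * ‖τ.1 - p.1‖ ^ 2 * (1 - ‖φ p‖ ^ 2))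
    {d : ℂ} (hd : 0 < d.re) :
    Tendsto (fun t : ℝ => (φ (τ.1 * (1 - t * d), τ.2) - ω) / t) (𝓝[>] 0) (𝓝 (-ω * (a * d))) := by
  have ha0 : 0 ≤ a := EReal.coe_nonneg.1 (ha ▸ hφ.caratheodoryLiminf_nonneg τ)
  have hωω : ω * conj ω = 1 := by rw [Complex.mul_conj', hω]; simp
  set f : ℂ → ℂ := fun z => conj ω * φ (τ.1 * z, τ.2) with hf
  have hmaps : ∀ z ∈ ball (0 : ℂ) 1, (τ.1 * z, τ.2) ∈ bidisk := fun z hz =>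
    ⟨by simpa [hτ₁] using hz, hτ₂⟩
  have hnorm : ∀ z, ‖f z‖ = ‖φ (τ.1 * z, τ.2)‖ := fun z => by simp [hf, hω]
  have hnorm1 : ∀ z, ‖1 - f z‖ = ‖ω - φ (τ.1 * z, τ.2)‖ := fun z =>
    norm_one_sub_conj_mul_of_norm_eq_one hω
  have hfd : DifferentiableOn ℂ f (ball 0 1) :=
    (hφ.1.comp (by fun_prop : DifferentiableOn ℂ (fun z : ℂ => (τ.1 * z, τ.2)) (ball 0 1))
      hmaps).const_mul _
  have hcurve : Tendsto (fun t : ℝ => ((τ.1 * (1 - t), τ.2) : ℂ × ℂ)) (𝓝[>] 0) (𝓝[bidisk] τ) := by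
    refine tendsto_nhdsWithin_iff.2 ⟨?_, ?_⟩
    · exact ((by fun_prop : Continuous fun t : ℝ => ((τ.1 * (1 - t), τ.2) : ℂ × ℂ)).tendsto' 0 τ
        (by simp)).mono_left nhdsWithin_le_nhds
    · have hball := eventually_one_sub_mul_mem_ball (d := 1) (by simp)
      simp only [mul_one] at hball
      exact hball.mono fun t ht => hmaps _ ht
  have key := tendsto_of_julia (f := f) (a := a) hfd
    (fun z hz => (hnorm z).trans_le (hφ.2 _ (hmaps z hz)))
    (fun z hz => by
      have := hJ _ (hmaps z hz)
      rw [hnorm, hnorm1]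
      simpa [← mul_one_sub, hτ₁] using this)
    (fun b hb => by
      have h1 : ∀ᶠ p in 𝓝[bidisk] τ, (b : EReal) < (((1 - ‖φ p‖) / (1 - ‖p‖) : ℝ) : EReal) :=
        eventually_lt_of_lt_liminf ((EReal.coe_lt_coe_iff.2 hb).trans_eq ha.symm)
      -- For `t < 1 - ‖τ.2‖` the first coordinate dominates, so the bidisk quotient is the radial
      -- one.
      filter_upwards [hcurve.eventually h1, Ioo_mem_nhdsGT (sub_pos.2 hτ₂)] with t ht ht1
      have ht2 : t < 1 - ‖τ.2‖ := ht1.2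
      have hn : ‖((τ.1 * (1 - t), τ.2) : ℂ × ℂ)‖ = 1 - t := by
        have : ‖(1 - t : ℂ)‖ = 1 - t := by
          rw [← Complex.ofReal_one, ← Complex.ofReal_sub, Complex.norm_real, Real.norm_of_nonneg]
          linarith [norm_nonneg τ.2]
        rw [Prod.norm_def, norm_mul, hτ₁, one_mul, this]
        exact max_eq_left (by linarith)
      rw [hn, sub_sub_cancel, EReal.coe_lt_coe_iff] at ht
      rwa [hnorm]) ha0 hd
  refine (key.const_mul (-ω)).congr fun t => ?_
  simp only [hf]
  rw [← mul_div_assoc]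
  congr 1
  linear_combination φ (τ.1 * (1 - t * d), τ.2) * hωω

theorem mainTheorem4 (φ : ℂ × ℂ → ℂ) (hφ : IsSchur φ)
    (τ : ℂ × ℂ) (hτ₁ : ‖τ.1‖ = 1) (hτ₂ : ‖τ.2‖ < 1) (hB : IsBPoint φ τ) :
    ∃ ω : ℂ, HasNontangentialLimit φ τ ω ∧
      ∀ δ : ℂ × ℂ, δ.1 ∈ (fun z : ℂ => τ.1 * z) '' rightHalfPlane →
        HasDirectionalDeriv φ τ ω (-δ)
          (-ω * (starRingEnd ℂ τ.1 * δ.1) * ((caratheodoryLiminf φ τ).toReal : ℂ)) := by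
  obtain ⟨a, ha⟩ : ∃ a : ℝ, caratheodoryLiminf φ τ = a :=
    ⟨_, (EReal.coe_toReal hB.2.ne
      ((EReal.bot_lt_zero.trans_le (hφ.caratheodoryLiminf_nonneg τ)).ne')).symm⟩
  have ha0 : 0 ≤ a := EReal.coe_nonneg.1 (ha ▸ hφ.caratheodoryLiminf_nonneg τ)
  obtain ⟨ω, hω, hJ⟩ := hφ.exists_julia hτ₁ hτ₂ ha
  refine ⟨ω, hasNontangentialLimit_of_julia ha0 hω hJ, ?_⟩
  rintro ⟨δ₁, δ₂⟩ ⟨d, hd, rfl : τ.1 * d = δ₁⟩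
  replace hd : 0 < d.re := hd
  have hslice := tendsto_slice_of_julia hφ hτ₁ hτ₂ ha hω hJ hd
  have hττ : conj τ.1 * τ.1 = 1 := by rw [Complex.conj_mul', hτ₁]; simp
  set A : ℝ → ℂ := fun t => τ.1 * (1 - t * d) with hA
  set B : ℝ → ℂ := fun t => τ.2 - t * δ₂ with hBdef
  have hA1 : ∀ᶠ t : ℝ in 𝓝[>] 0, ‖A t‖ < 1 :=
    (eventually_one_sub_mul_mem_ball hd).mono fun t ht => by simpa [hA, hτ₁] using ht
  have hB1 : ∀ᶠ t : ℝ in 𝓝[>] 0, ‖B t‖ < 1 := by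
    have : Tendsto (fun t => ‖B t‖) (𝓝[>] 0) (𝓝 ‖τ.2‖) :=
      ((by fun_prop : Continuous fun t => ‖B t‖).tendsto' 0 _ (by simp [hBdef])).mono_left
        nhdsWithin_le_nhds
    exact this.eventually_lt_const hτ₂
  have hpos : ∀ᶠ t : ℝ in 𝓝[>] 0, 0 < t := eventually_mem_nhdsWithin
  have ht0 : Tendsto (fun t : ℝ => t) (𝓝[>] 0) (𝓝 0) := nhdsWithin_le_nhds
  -- along any path with first coordinate `A`, the function tends to `ω`
  have hconv : ∀ C : ℝ → ℂ, (∀ᶠ t in 𝓝[>] 0, ‖C t‖ < 1) →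
      Tendsto (fun t => φ (A t, C t)) (𝓝[>] 0) (𝓝 ω) := by
    intro C hC
    rw [tendsto_iff_norm_sub_tendsto_zero]
    have hlim : Tendsto (fun t : ℝ => t * (2 * a * ‖d‖ ^ 2 / d.re)) (𝓝[>] 0) (𝓝 0) := by
      simpa using ht0.mul_const (2 * a * ‖d‖ ^ 2 / d.re)
    refine squeeze_zero' (Eventually.of_forall fun _ => norm_nonneg _) ?_ hlim
    filter_upwards [hA1, hC, eventually_le_one_sub_norm_sq hd] with t h1 h2 h3
    have hp : (A t, C t) ∈ bidisk := ⟨h1, h2⟩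
    have h4 := norm_sub_mul_le_of_julia hω (by positivity) (hJ _ hp)
    have h5 : ‖τ.1 - A t‖ = t * ‖d‖ := by
      rw [hA, show τ.1 - τ.1 * (1 - t * d) = τ.1 * (t * d) by ring, norm_mul, norm_mul, hτ₁,
        one_mul, Complex.norm_real, Real.norm_of_nonneg h3.1.le]
    have h6 : ‖A t‖ = ‖1 - t * d‖ := by rw [hA, norm_mul, hτ₁, one_mul]
    rw [h5, h6] at h4
    rw [norm_sub_rev]
    have h7 : 0 < t * d.re := mul_pos h3.1 hd
    refine le_of_mul_le_mul_right ((mul_le_mul_of_nonneg_left h3.2 (norm_nonneg _)).trans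
      (h4.trans_eq ?_)) h7
    field_simp
  have hP := hconv B hB1
  have hQ := hconv (fun _ => τ.2) (Eventually.of_forall fun _ => hτ₂)
  -- Schwarz–Pick with `r = t * k`, where `k` comes from `‖1 - conj τ.2 * B t‖ ≥ 1 - ‖τ.2‖`. The
  -- remaining factor tends to `1 - ‖ω‖ ^ 2 = 0`.
  have hdiff : Tendsto (fun t : ℝ => (φ (A t, B t) - φ (A t, τ.2)) / t) (𝓝[>] 0) (𝓝 0) := by
    set k := ‖δ₂‖ / (1 - ‖τ.2‖) with hk
    have hτpos := sub_pos.2 hτ₂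
    have h1 : Tendsto (fun t => k * ‖1 - conj (φ (A t, τ.2)) * φ (A t, B t)‖) (𝓝[>] 0) (𝓝 0) := by
      have := (((((Complex.continuous_conj.tendsto ω).comp hQ).mul hP).const_sub 1).norm).const_mul k
      rw [Complex.conj_mul', hω] at this
      simpa using this
    refine squeeze_zero_norm' ?_ h1
    have hkt : ∀ᶠ t : ℝ in 𝓝[>] 0, t * k < 1 := by
      have : Tendsto (fun t : ℝ => t * k) (𝓝[>] 0) (𝓝 0) := by simpa using ht0.mul_const k
      exact this.eventually_lt_const one_pos
    filter_upwards [hA1, hB1, hpos, hkt] with t h2 h3 ht h4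
    have h5 := hφ.schwarzPick (p := (A t, B t)) (q := (A t, τ.2)) ⟨h2, h3⟩ ⟨h2, hτ₂⟩ h4
      (by rw [sub_self, norm_zero]; positivity) (by
        have h6 : 1 - ‖τ.2‖ ≤ ‖1 - conj τ.2 * B t‖ := by
          have h7 := norm_sub_norm_le 1 (conj τ.2 * B t)
          rw [norm_one, norm_mul, RCLike.norm_conj] at h7
          nlinarith [norm_nonneg τ.2]
        have h8 : ‖B t - τ.2‖ = t * ‖δ₂‖ := by
          rw [hBdef, sub_sub_cancel_left, norm_neg, norm_mul, Complex.norm_real,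
            Real.norm_of_nonneg ht.le]
        calc ‖B t - τ.2‖ = t * k * (1 - ‖τ.2‖) := by rw [h8, hk]; field_simp
          _ ≤ t * k * ‖1 - conj τ.2 * B t‖ := by gcongr)
    rw [norm_div, Complex.norm_real, Real.norm_of_nonneg ht.le, div_le_iff₀ ht]
    linarith
  have hsum := hdiff.add hslice
  rw [HasDirectionalDeriv, ha, EReal.toReal_coe]
  have hval : -ω * (conj τ.1 * (τ.1 * d)) * (a : ℂ) = 0 + -ω * (a * d) := by
    linear_combination (-ω * d * a) * hττ
  rw [hval]
  refine hsum.congr fun t => ?_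
  have hpt : τ + t • -(τ.1 * d, δ₂) = (A t, B t) := by
    refine Prod.ext ?_ ?_
    · simp [hA]; ring
    · simp [hBdef]; ring
  rw [hpt, ← add_div]
  congr 1
  ring
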